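/- Let $d$ be a positive integer and let $q_1,\dots,q_d$ be positive integers, at least one of which is even and at least $4$. Put $\Gamma=q_1\mathbb{Z}\oplus\cdots\oplus q_d\mathbb{Z}$ and $Q=q_1\cdots q_d$. The discrete Laplacian on $\mathbb{Z}^d$ is $(\Delta u)(n)=\sum_{|n'-n|_1=1}u(n')$, where $|n'-n|_1=\sum_{i=1}^d|n'_i-n_i|$. A function $V:\mathbb{Z}^d\to\mathbb{C}$ is $\Gamma$-periodic if $V(n+m)=V(n)$ for all $n\in\mathbb{Z}^d$ and $m\in\Gamma$. For a $\Gamma$-periodic $V$ and $k\in\mathbb{R}^d$, let $D_V(k)$ be the $Q\times Q$ complex matrix of the operator $u\mapsto\Delta u+Vu$ acting on the $Q$-dimensional space of functions $u:\mathbb{Z}^d\to\mathbb{C}$ with $u(n+q_je_j)=e^{2\pi i k_j}u(n)$ for all $n\in\mathbb{Z}^d$ and $1\le j\le d$ (where $e_j$ is the $j$-th standard basis vector), such a function being identified with its restriction to the cell $\prod_{j=1}^d\{0,\dots,q_j-1\}$. Let $\sigma_V(k)$ be the multiset of eigenvalues of $D_V(k)$, counted with algebraic multiplicity. Then there is a $\Gamma$-periodic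 potential $V:\mathbb{Z}^d\to\mathbb{C}$, not identically zero, which is Floquet isospectral to the zero potential $\mathbf{0}$, that is, $\sigma_V(k)=\sigma_{\mathbf{0}}(k)$ for every $k\in\mathbb{R}^d$. (Equivalently, $\det(D_V(k)-\lambda I)=\det(D_{\mathbf{0}}(k)-\lambda I)$ for all $k\in\mathbb{R}^d$ and $\lambda\in\mathbb{C}$.) -/

import Mathlib

/-- The discrete Laplacian on `ℤ^d`: `(Δu)(n)` is the sum of `u(n')` over all `n'` with
`|n' - n|₁ = 1` (a finite set of lattice points). -/
noncomputable def discreteLaplacian {d : ℕ} (u : (Fin d → ℤ) → ℂ) (n : Fin d → ℤ) : ℂ :=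
  ∑ᶠ n' ∈ {n' : Fin d → ℤ | ∑ i, |n' i - n i| = 1}, u n'

/-- The discrete Schrödinger operator `Δ + V`. -/
noncomputable def schrodinger {d : ℕ} (V u : (Fin d → ℤ) → ℂ) (n : Fin d → ℤ) : ℂ :=
  discreteLaplacian u n + V n * u n

/-- The lattice `Γ = q₁ℤ ⊕ ⋯ ⊕ q_dℤ` in `ℤ^d`. -/
def periodLattice {d : ℕ} (q : Fin d → ℕ+) : AddSubgroup (Fin d → ℤ) :=
  AddSubgroup.pi Set.univ fun j => AddSubgroup.zmultiples ((q j : ℕ) : ℤ)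

/-- `V` is `Γ`-periodic: `V(n + m) = V(n)` for all `n ∈ ℤ^d` and `m ∈ Γ`. -/
def IsLatticePeriodic {d : ℕ} (q : Fin d → ℕ+) (V : (Fin d → ℤ) → ℂ) : Prop :=
  ∀ n : Fin d → ℤ, ∀ m ∈ periodLattice q, V (n + m) = V n

/-- The standard fundamental cell of `Γ`, with `Q = q₁ ⋯ q_d` elements; an element stands for
the lattice point with coordinates in `{0, …, q_j - 1}`. -/
abbrev PeriodCell {d : ℕ} (q : Fin d → ℕ+) : Type :=
  (j : Fin d) → Fin (q j : ℕ)

/-- An element of the fundamental cell as a point of `ℤ^d`. -/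
def cellPoint {d : ℕ} {q : Fin d → ℕ+} (r : PeriodCell q) : Fin d → ℤ :=
  fun j => ((r j : ℕ) : ℤ)

/-- The representative in the fundamental cell of a lattice point modulo `Γ`. -/
def cellResidue {d : ℕ} (q : Fin d → ℕ+) (n : Fin d → ℤ) : PeriodCell q :=
  fun j => ⟨(n j % ((q j : ℕ) : ℤ)).toNat, by
    have h : (0 : ℤ) < ((q j : ℕ) : ℤ) := by exact_mod_cast (q j).pos
    have h1 := Int.emod_nonneg (n j) h.ne'
    have h2 := Int.emod_lt_of_pos (n j) h
    omega⟩

/-- The unique function `u` on `ℤ^d` that agrees with `f` on the fundamental cell and satisfies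
the Floquet boundary condition `u(n + q_j e_j) = e^{2πi k_j} u(n)` for all `n` and `j`. -/
noncomputable def floquetExtension {d : ℕ} (q : Fin d → ℕ+) (k : Fin d → ℝ)
    (f : PeriodCell q → ℂ) (n : Fin d → ℤ) : ℂ :=
  (∏ j, Complex.exp (2 * Real.pi * Complex.I * (k j : ℂ)) ^ (n j / ((q j : ℕ) : ℤ))) *
    f (cellResidue q n)

/-- The `Q × Q` matrix `D_V(k)` of `Δ + V` on functions that satisfy the Floquet boundary
condition with quasimomentum `k`, such functions being identified with their restrictions to the
fundamental cell: column `s` is the restriction of `(Δ + V)u`, where `u` is the Floquet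
extension of the `s`-th unit vector. -/
noncomputable def floquetMatrix {d : ℕ} (q : Fin d → ℕ+) (V : (Fin d → ℤ) → ℂ)
    (k : Fin d → ℝ) : Matrix (PeriodCell q) (PeriodCell q) ℂ :=
  Matrix.of fun r s => schrodinger V (floquetExtension q k (Pi.single s 1)) (cellPoint r)

/-- `σ_V(k)`: the eigenvalues of `D_V(k)`, counted with algebraic multiplicity. -/
noncomputable def floquetSpectrum {d : ℕ} (q : Fin d → ℕ+) (V : (Fin d → ℤ) → ℂ)
    (k : Fin d → ℝ) : Multiset ℂ :=
  (floquetMatrix q V k).charpoly.roots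

/-- The (`Γ`-periodic) potentials `V` and `V'` are Floquet isospectral: `σ_V(k) = σ_{V'}(k)`
for all `k ∈ ℝ^d`. -/
def FloquetIsospectral {d : ℕ} (q : Fin d → ℕ+) (V V' : (Fin d → ℤ) → ℂ) : Prop :=
  ∀ k : Fin d → ℝ, floquetSpectrum q V k = floquetSpectrum q V' k

/-! The potential is chosen to depend on one coordinate `j₀` only, with `q j₀ = 2m` and `m ≥ 2`. Its
Floquet matrix is then a Kronecker sum of a one-dimensional Floquet matrix `A` and a matrix `B`
independent of the potential, and `charpoly_kroneckerSum` shows that only the characteristic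
polynomial of `A` matters.

In one dimension this is Floquet theory: by `det_cyclicJacobi_mul_sign`, the characteristic
polynomial of `A` is, up to a sign, `z + z⁻¹` minus the trace of the transfer matrix over a period
(the discriminant). A nonzero `v` with the discriminant of `0` is thus enough. Placing `a, b` at `0,
1` and `-b, -a` half a period later works when `ab = 2` and `a² + b² = 0`
(`trace_transferMatrix_defect`), for instance with `a = 1 - i`, `b = 1 + i`. -/

open Matrix Polynomial in
/-- The characteristic polynomial of a Kronecker sum depends on the left summand only through its
characteristic polynomial. -/
theorem charpoly_kroneckerSum {R m n : Type*} [CommRing R] [Fintype m] [Fintype n]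
    [DecidableEq m] [DecidableEq n] (A : Matrix m m R) (B : Matrix n n R) :
    (Matrix.of fun r s : m × n =>
        A r.1 s.1 * (if r.2 = s.2 then 1 else 0) + (if r.1 = s.1 then 1 else 0) * B r.2 s.2).charpoly =
      (aeval (charmatrix B) A.charpoly).det := by
  -- Substituting `charmatrix B` for `X` in `charmatrix A` gives the blocks of the characteristic
  -- matrix of the Kronecker sum. These blocks commute, so the determinant can be taken blockwise
  -- first.
  have h := Matrix.det_det (charmatrix A)
    ((aeval (R := R) (charmatrix B)).toRingHom : R[X] →+* Matrix n n R[X])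
  refine Eq.trans ?_ h.symm
  unfold Matrix.charpoly
  congr 1
  ext1 r s
  obtain ⟨i, k⟩ := r
  obtain ⟨j, l⟩ := s
  by_cases hij : i = j <;> by_cases hkl : k = l <;>
    simp [Matrix.comp_apply, Matrix.algebraMap_matrix_apply, hij, hkl]
  ring

/-! ### Determinants of periodic Jacobi matrices -/

section CyclicJacobi

variable {R : Type*} [CommRing R]

/-- The one-step transfer matrix of the three-term recurrence `u (n + 1) = x * u n - u (n - 1)`. -/
def transferMatrix (x : R) : Matrix (Fin 2) (Fin 2) R := !![x, -1; 1, 0]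

/-- The transfer matrix from step `0` to step `n`. -/
def transferProduct (x : ℕ → R) : ℕ → Matrix (Fin 2) (Fin 2) R
  | 0 => 1
  | n + 1 => transferMatrix (x n) * transferProduct x n

theorem det_transferMatrix (x : R) : (transferMatrix x).det = 1 := by
  simp [transferMatrix, Matrix.det_fin_two]

theorem det_transferProduct (x : ℕ → R) (n : ℕ) : (transferProduct x n).det = 1 := by
  induction n with
  | zero => simp [transferProduct]
  | succ n ih => rw [transferProduct, Matrix.det_mul, det_transferMatrix, ih, one_mul]

theorem transferProduct_succ_one (x : ℕ → R) (n : ℕ) (j : Fin 2) :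
    transferProduct x (n + 1) 1 j = transferProduct x n 0 j := by
  simp [transferProduct, transferMatrix, Matrix.mul_apply, Fin.sum_univ_two]

theorem transferProduct_add_two_zero (x : ℕ → R) (n : ℕ) (j : Fin 2) :
    transferProduct x (n + 2) 0 j =
      x (n + 1) * transferProduct x (n + 1) 0 j - transferProduct x n 0 j := by
  rw [← transferProduct_succ_one x n j, transferProduct]
  simp [transferMatrix, Matrix.mul_apply, Fin.sum_univ_two, sub_eq_add_neg]

/-- The periodic Jacobi matrix with diagonal `x`, off-diagonal entries `-1`, and corner entries
`-z` and `-w`. -/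
def cyclicJacobi (q : ℕ) (x : ℕ → R) (z w : R) : Matrix (Fin q) (Fin q) R :=
  Matrix.of fun i j =>
    (if (j : ℕ) = i then x i else 0) - (if (j : ℕ) = i + 1 then 1 else 0) -
      (if (i : ℕ) = j + 1 then 1 else 0) - (if (i : ℕ) + 1 = q ∧ (j : ℕ) = 0 then z else 0) -
      (if (i : ℕ) = 0 ∧ (j : ℕ) + 1 = q then w else 0)

/-- The rows of a cyclic Jacobi matrix pair with a sequence as a three-term recurrence. -/
theorem sum_cyclicJacobi_mul (p : ℕ) (x : ℕ → R) (z w : R) (f : ℕ → R) (i : Fin (2 + p)) :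
    ∑ j : Fin (2 + p), cyclicJacobi (2 + p) x z w i j * f j =
      x i * f i - (if (i : ℕ) + 1 < 2 + p then f (i + 1) else 0) -
        (if (i : ℕ) = 0 then 0 else f (i - 1)) - (if (i : ℕ) + 1 = 2 + p then z * f 0 else 0) -
        (if (i : ℕ) = 0 then w * f (1 + p) else 0) := by
  obtain ⟨i, hi⟩ := i
  simp only [cyclicJacobi, Matrix.of_apply, sub_mul, Finset.sum_sub_distrib, ite_mul, zero_mul,
    one_mul]
  congr 1
  · congr 1
    · congr 1
      · congr 1
        · rw [Fin.sum_univ_eq_sum_range (fun j => if j = i then x i * f j else 0) (2 + p)]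
          simp [hi]
        · rw [Fin.sum_univ_eq_sum_range (fun j => if j = i + 1 then f j else 0) (2 + p)]
          simp
      · rw [Fin.sum_univ_eq_sum_range (fun j => if i = j + 1 then f j else 0) (2 + p)]
        rcases i with _ | i
        · simp
        · simp [show i < 2 + p by omega]
    · rw [Fin.sum_univ_eq_sum_range (fun j => if i + 1 = 2 + p ∧ j = 0 then z * f j else 0) (2 + p)]
      by_cases h : i + 1 = 2 + p <;> simp [h]
  · rw [Fin.sum_univ_eq_sum_range
      (fun j => if i = 0 ∧ j + 1 = 2 + p then w * f j else 0) (2 + p)]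
    have h : ∀ j, j + 1 = 2 + p ↔ j = 1 + p := fun j => by omega
    by_cases h0 : i = 0 <;> simp [h0, h, show 1 + p < 2 + p by omega]

/-- The cyclic shift `i ↦ i - 1`. -/
def cyclicPred (p : ℕ) : Equiv.Perm (Fin (2 + p)) where
  toFun i := ⟨if (i : ℕ) = 0 then 1 + p else i - 1, by split_ifs <;> omega⟩
  invFun i := ⟨if (i : ℕ) = 1 + p then 0 else i + 1, by split_ifs <;> omega⟩
  left_inv i := by ext; grind
  right_inv i := by ext; grind

theorem cyclicPred_val (p : ℕ) (i : Fin (2 + p)) :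
    (cyclicPred p i : ℕ) = if (i : ℕ) = 0 then 1 + p else i - 1 := rfl

/-- The unipotent matrix whose first two columns are the basic solutions of the recurrence. -/
def solutionMatrix (p : ℕ) (x : ℕ → R) : Matrix (Fin (2 + p)) (Fin (2 + p)) R :=
  Matrix.of fun i j =>
    if (j : ℕ) = 0 then transferProduct x i 0 0 + x 0 * transferProduct x i 0 1
    else if (j : ℕ) = 1 then -transferProduct x i 0 1
    else if (i : ℕ) = j then 1 else 0

theorem det_solutionMatrix (p : ℕ) (x : ℕ → R) : (solutionMatrix p x).det = 1 := by
  rw [Matrix.det_of_isLowerTriangular]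
  · refine Finset.prod_eq_one fun i _ => ?_
    obtain ⟨i, hi⟩ := i
    rcases i with _ | _ | i <;>
      simp [solutionMatrix, transferProduct, transferMatrix]
  · intro i j hij
    obtain ⟨i, hi⟩ := i
    obtain ⟨j, hj⟩ := j
    have hij : i < j := by simpa using hij
    rcases j with _ | _ | j
    · omega
    · obtain rfl : i = 0 := by omega
      simp [solutionMatrix, transferProduct]
    · simp [solutionMatrix, show i ≠ j + 2 by omega]

/-- Shift the rows cyclically so that the two boundary rows come first, then replace the first two
columns by combinations given by the solutions `c`, `s` with initial data `(1, 0)` and `(0, 1)`. All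
other rows annihilate these solutions, so the matrix becomes block triangular: a triangular block
with diagonal `-1`, and a 2×2 block of boundary conditions that yields the discriminant. -/
theorem det_cyclicJacobi_mul_sign (p : ℕ) (x : ℕ → R) (z w : R) (hzw : z * w = 1) :
    ((Equiv.Perm.sign (cyclicPred p) : ℤ) : R) * (cyclicJacobi (2 + p) x z w).det =
      (-1) ^ p * (z + w - (transferProduct x (2 + p)).trace) := by
  set M := (cyclicJacobi (2 + p) x z w).submatrix (cyclicPred p) id with hM
  set N := (M * solutionMatrix p x).submatrix (finSumFinEquiv (m := 2) (n := p))
    (finSumFinEquiv (m := 2) (n := p)) with hN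
  have hdet : N.det = ((Equiv.Perm.sign (cyclicPred p) : ℤ) : R) *
      (cyclicJacobi (2 + p) x z w).det := by
    rw [hN, Matrix.det_submatrix_equiv_self, Matrix.det_mul, det_solutionMatrix, mul_one, hM,
      Matrix.det_permute]
  have hcol : ∀ i j, ∀ f : ℕ → R, (∀ k, solutionMatrix p x k j = f k) →
      (M * solutionMatrix p x) i j =
        ∑ k : Fin (2 + p), cyclicJacobi (2 + p) x z w (cyclicPred p i) k * f k := by
    intro i j f hf
    simp [Matrix.mul_apply, hM, hf]
  set c : ℕ → R := fun n => transferProduct x n 0 0 + x 0 * transferProduct x n 0 1 with hc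
  set s : ℕ → R := fun n => -transferProduct x n 0 1 with hs
  have hcrec : ∀ n, c (n + 2) = x (n + 1) * c (n + 1) - c n := fun n => by
    simp only [hc, transferProduct_add_two_zero]; ring
  have hsrec : ∀ n, s (n + 2) = x (n + 1) * s (n + 1) - s n := fun n => by
    simp only [hs, transferProduct_add_two_zero]; ring
  have hc0 : c 0 = 1 := by simp [hc, transferProduct]
  have hs0 : s 0 = 0 := by simp [hs, transferProduct]
  have hc1 : c 1 = 0 := by simp [hc, transferProduct, transferMatrix]
  have hs1 : s 1 = 1 := by simp [hs, transferProduct, transferMatrix]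
  have hN0 : ∀ i : Fin 2 ⊕ Fin p, N i (Sum.inl 0) =
      ∑ k : Fin (2 + p), cyclicJacobi (2 + p) x z w (cyclicPred p (finSumFinEquiv i)) k * c k :=
    fun i => hcol _ _ c fun k => by simp [solutionMatrix, hc, -Fin.val_eq_zero_iff]
  have hN1 : ∀ i : Fin 2 ⊕ Fin p, N i (Sum.inl 1) =
      ∑ k : Fin (2 + p), cyclicJacobi (2 + p) x z w (cyclicPred p (finSumFinEquiv i)) k * s k :=
    fun i => hcol _ _ s fun k => by simp [solutionMatrix, hs, -Fin.val_eq_zero_iff]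
  have hN2 : ∀ (i : Fin 2 ⊕ Fin p) (j : Fin p), N i (Sum.inr j) =
      cyclicJacobi (2 + p) x z w (cyclicPred p (finSumFinEquiv i)) (Fin.natAdd 2 j) := by
    intro i j
    rw [hN, Matrix.submatrix_apply, hcol _ _ (fun k => if k = 2 + (j : ℕ) then 1 else 0)]
    · simp only [mul_ite, mul_one, mul_zero]
      rw [Finset.sum_eq_single (Fin.natAdd 2 j)]
      · simp
      · intro b _ hb
        rw [if_neg]
        intro h
        exact hb (Fin.ext (by simpa using h))
      · simp
    · intro k
      simp [solutionMatrix, -Fin.val_eq_zero_iff, show 2 + (j : ℕ) ≠ 1 by omega]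
  have h21 : N.toBlocks₂₁ = 0 := by
    ext i j
    have e : ((cyclicPred p (finSumFinEquiv (Sum.inr i)) : Fin (2 + p)) : ℕ) = i + 1 := by
      simp [cyclicPred_val, -Fin.val_eq_zero_iff]; omega
    have hi := i.2
    fin_cases j
    · simp only [Matrix.toBlocks₂₁, Matrix.of_apply, Fin.zero_eta, hN0, sum_cyclicJacobi_mul, e]
      simp [hcrec, show (i : ℕ) + 1 + 1 < 2 + p by omega, show (i : ℕ) + 1 + 1 ≠ 2 + p by omega]
    · simp only [Matrix.toBlocks₂₁, Matrix.of_apply, Fin.mk_one, hN1, sum_cyclicJacobi_mul, e]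
      simp [hsrec, show (i : ℕ) + 1 + 1 < 2 + p by omega, show (i : ℕ) + 1 + 1 ≠ 2 + p by omega]
  have h22 : N.toBlocks₂₂.det = (-1) ^ p := by
    rw [Matrix.det_of_isLowerTriangular]
    · rw [Finset.prod_congr rfl (g := fun _ => (-1 : R)), Finset.prod_const, Finset.card_univ,
        Fintype.card_fin]
      intro i _
      have hi := i.2
      simp only [Matrix.toBlocks₂₂, Matrix.of_apply, hN2, cyclicJacobi]
      simp [cyclicPred_val, -Fin.val_eq_zero_iff, 
        show 2 + (i : ℕ) = 1 + i + 1 by omega, show 1 + (i : ℕ) ≠ 1 + i + 1 + 1 by omega]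
    · intro i j hij
      have hij : (i : ℕ) < j := by simpa using hij
      have hj := j.2
      simp only [Matrix.toBlocks₂₂, Matrix.of_apply, hN2, cyclicJacobi]
      simp [cyclicPred_val, -Fin.val_eq_zero_iff, show 2 + (i : ℕ) - 1 = 1 + i by omega,
        show 2 + (j : ℕ) ≠ 1 + i by omega, show 2 + (j : ℕ) ≠ 1 + i + 1 by omega,
        show 1 + (i : ℕ) ≠ 2 + j + 1 by omega]
  have e0 : ((cyclicPred p (finSumFinEquiv (Sum.inl 0 : Fin 2 ⊕ Fin p)) : Fin (2 + p)) : ℕ) =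
      1 + p := by simp [cyclicPred_val, -Fin.val_eq_zero_iff]
  have e1 : ((cyclicPred p (finSumFinEquiv (Sum.inl 1 : Fin 2 ⊕ Fin p)) : Fin (2 + p)) : ℕ) =
      0 := by simp [cyclicPred_val, -Fin.val_eq_zero_iff]
  have h11 : N.toBlocks₁₁.det = z + w - (transferProduct x (2 + p)).trace := by
    have hd := det_transferProduct x (2 + p)
    have hcq := hcrec p
    have hsq := hsrec p
    rw [Matrix.det_fin_two] at hd ⊢
    rw [Matrix.trace_fin_two]
    simp only [Matrix.toBlocks₁₁, Matrix.of_apply, hN0, hN1, sum_cyclicJacobi_mul, e0, e1]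
    simp only [show 2 + p = p + 1 + 1 by omega, show 1 + p = p + 1 by omega,
      transferProduct_succ_one] at hd hcq hsq ⊢
    simp [hc0, hs0, hc1, hs1]
    have hcq' : x (p + 1) * c (p + 1) - c p = c (p + 1 + 1) := hcq.symm
    have hsq' : x (p + 1) * s (p + 1) - s p = s (p + 1 + 1) := hsq.symm
    rw [hcq', hsq']
    simp only [hc, hs]
    -- `hd` is the constancy of the Wronskian; it turns the coefficient of `w` into `1`.
    linear_combination w * hd - transferProduct x (p + 1) 0 1 * hzw
  rw [← hdet, ← Matrix.fromBlocks_toBlocks N, h21, Matrix.det_fromBlocks_zero₂₁, h11, h22]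
  ring

/-- The determinant of a cyclic Jacobi matrix depends on the diagonal only through the trace of
the transfer matrix. -/
theorem det_cyclicJacobi_congr (p : ℕ) {x y : ℕ → R} {z w : R} (hzw : z * w = 1)
    (h : (transferProduct x (2 + p)).trace = (transferProduct y (2 + p)).trace) :
    (cyclicJacobi (2 + p) x z w).det = (cyclicJacobi (2 + p) y z w).det := by
  have h1 := det_cyclicJacobi_mul_sign p x z w hzw
  rw [h, ← det_cyclicJacobi_mul_sign p y z w hzw] at h1
  -- The sign of the shift is a unit in any ring, so it cancels without being computed.
  have hu : IsUnit ((Equiv.Perm.sign (cyclicPred p) : ℤ) : R) :=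
    (Units.isUnit (Equiv.Perm.sign (cyclicPred p))).map (Int.castRingHom R)
  exact hu.mul_left_cancel h1

end CyclicJacobi

/-! ### A perturbation that preserves the discriminant -/

section TraceIdentity

variable {R : Type*} [CommRing R]

theorem transferProduct_const_stretch {x : ℕ → R} {t : R} {n : ℕ} :
    ∀ l : ℕ, (∀ i < l, x (n + i) = t) →
      transferProduct x (n + l) = transferMatrix t ^ l * transferProduct x n
  | 0, _ => by simp
  | l + 1, h => by
    rw [← add_assoc, transferProduct, h l l.lt_succ_self,
      transferProduct_const_stretch l fun i hi => h i (hi.trans l.lt_succ_self), pow_succ',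
      mul_assoc]

/-- Two antisymmetric two-site defects with values `a, b` and `-b, -a`, where `a * b = 2` and
`a ^ 2 + b ^ 2 = 0`, do not change the trace of the transfer matrix. -/
theorem trace_transferMatrix_defect (t a b : R) (hab : a * b = 2) (hsq : a ^ 2 + b ^ 2 = 0)
    {N : Matrix (Fin 2) (Fin 2) R} (hN : Commute N (transferMatrix t)) (hdet : N.det = 1) :
    (N * (transferMatrix (t + a) * (transferMatrix (t + b) *
      (N * (transferMatrix (t - b) * transferMatrix (t - a)))))).trace =
    (N * (transferMatrix t * (transferMatrix t *
      (N * (transferMatrix t * transferMatrix t))))).trace := by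
  have h := hN.eq
  have h00 := congrFun (congrFun h 0) 0
  have h10 := congrFun (congrFun h 1) 0
  rw [Matrix.det_fin_two] at hdet
  simp [transferMatrix, Matrix.mul_apply, Fin.sum_univ_two] at h00 h10
  -- Commuting with `transferMatrix t` makes `N` a combination of it and the identity, so two
  -- entries determine `N`.
  have h01 : N 0 1 = - N 1 0 := by linear_combination h00
  have h11 : N 1 1 = N 0 0 - t * N 1 0 := by linear_combination h10
  rw [h01, h11] at hdet
  rw [Matrix.eta_fin_two N, h01, h11]
  generalize N 0 0 = p at *
  generalize N 1 0 = r at *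
  clear h00 h10 h01 h11 h hN
  simp only [transferMatrix, Matrix.trace_fin_two, Matrix.mul_fin_two, Matrix.of_apply,
    Matrix.cons_val', Matrix.cons_val_zero, Matrix.cons_val_one, Matrix.cons_val_fin_one]
  -- The first-order terms of the two defects sum to `2ab` times the upper left entry of `N T² N`,
  -- with `T = transferMatrix t`; the second-order term cancels this, by the relations on `a, b` and
  -- `det N = 1`.
  grind

end TraceIdentity

open Polynomial in
theorem trace_transferProduct_defect {m : ℕ} (hm : 2 ≤ m) (v : ℕ → ℂ) {a b : ℂ} (hab : a * b = 2)
    (hsq : a ^ 2 + b ^ 2 = 0) (h0 : v 0 = a) (h1 : v 1 = b) (h2 : v m = -b) (h3 : v (m + 1) = -a)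
    (hv : ∀ n < m + m, n ≠ 0 → n ≠ 1 → n ≠ m → n ≠ m + 1 → v n = 0) :
    (transferProduct (fun n => (X - C (v n) : ℂ[X])) (m + m)).trace =
      (transferProduct (fun _ => (X : ℂ[X])) (m + m)).trace := by
  obtain ⟨l, rfl⟩ := Nat.exists_eq_add_of_le hm
  have hl : 2 + l + (2 + l) = 2 + l + 1 + 1 + l := by omega
  rw [hl]
  rw [transferProduct_const_stretch (t := (X : ℂ[X])) l, transferProduct, transferProduct,
    transferProduct_const_stretch (t := (X : ℂ[X])) l, transferProduct, transferProduct,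
    transferProduct]
  · rw [transferProduct_const_stretch (t := (X : ℂ[X])) l, transferProduct, transferProduct,
      transferProduct_const_stretch (t := (X : ℂ[X])) l, transferProduct, transferProduct,
      transferProduct]
    · have key := trace_transferMatrix_defect (X : ℂ[X]) (C a) (C b) (by rw [← C_mul, hab]; rfl)
        (by rw [← C_pow, ← C_pow, ← C_add, hsq, C_0])
        (N := transferMatrix X ^ l) ((Commute.refl _).pow_left l)
        (by rw [Matrix.det_pow, det_transferMatrix, one_pow])
      simp only [h0, h1, h2, h3, mul_one, C_neg, sub_neg_eq_add]
      exact key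
    · simp
    · simp
  · intro i hi
    rw [hv, C_0, sub_zero] <;> omega
  · intro i hi
    rw [hv, C_0, sub_zero] <;> omega

/-! ### One-dimensional Floquet matrices -/

/-- The Floquet extension, in one dimension, of the unit vector at `s`. -/
noncomputable def floquetFactor (q : ℕ) (z : ℂ) (t : ℤ) (s : Fin q) : ℂ :=
  z ^ (t / (q : ℤ)) * if (t % (q : ℤ)).toNat = s then 1 else 0

theorem floquetFactor_natCast (q : ℕ) (z : ℂ) (r s : Fin q) :
    floquetFactor q z ((r : ℕ) : ℤ) s = if r = s then 1 else 0 := by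
  have hr := r.2
  rw [floquetFactor, Int.ediv_eq_zero_of_lt (by omega) (by omega),
    Int.emod_eq_of_lt (by omega) (by omega)]
  simp [Fin.ext_iff]

/-- The matrix of the one-dimensional discrete Laplacian with Floquet multiplier `z`. -/
noncomputable def floquetHop (q : ℕ) (z : ℂ) : Matrix (Fin q) (Fin q) ℂ :=
  Matrix.of fun r s =>
    floquetFactor q z (((r : ℕ) : ℤ) + 1) s + floquetFactor q z (((r : ℕ) : ℤ) - 1) s

theorem floquetFactor_add_one (q : ℕ) (z : ℂ) (r s : Fin q) :
    floquetFactor q z (((r : ℕ) : ℤ) + 1) s =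
      (if (s : ℕ) = r + 1 then 1 else 0) + if (r : ℕ) + 1 = q ∧ (s : ℕ) = 0 then z else 0 := by
  have hr := r.2
  have hs := s.2
  by_cases h : (r : ℕ) + 1 = q
  · have e : ((r : ℕ) : ℤ) + 1 = q := by exact_mod_cast h
    rw [floquetFactor, e, Int.ediv_self (by omega), Int.emod_self, if_neg (by omega : ¬(s : ℕ) = r + 1)]
    simp only [h, zpow_one, Int.toNat_zero, true_and, zero_add, mul_ite, mul_one, mul_zero]
    congr 1
    exact propext eq_comm
  · rw [floquetFactor, Int.ediv_eq_zero_of_lt (by omega) (by omega),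
      Int.emod_eq_of_lt (by omega) (by omega)]
    simp only [h, zpow_zero, one_mul, false_and, if_false, add_zero]
    congr 1
    exact propext ⟨fun h => by omega, fun h => by omega⟩

theorem floquetFactor_sub_one (q : ℕ) (z : ℂ) (r s : Fin q) :
    floquetFactor q z (((r : ℕ) : ℤ) - 1) s =
      (if (r : ℕ) = s + 1 then 1 else 0) + if (r : ℕ) = 0 ∧ (s : ℕ) + 1 = q then z⁻¹ else 0 := by
  have hr := r.2
  have hs := s.2
  by_cases h : (r : ℕ) = 0
  · have hq : (0 : ℤ) < q := by omega
    have e1 : (((r : ℕ) : ℤ) - 1) / (q : ℤ) = -1 := by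
      rw [h, Int.ediv_eq_iff_of_pos hq]
      omega
    have e2 : (((r : ℕ) : ℤ) - 1) % (q : ℤ) = q - 1 := by
      rw [Int.emod_def, e1, h]
      ring
    rw [floquetFactor, e1, e2, if_neg (by omega : ¬(r : ℕ) = s + 1)]
    simp only [h, zpow_neg_one, true_and, zero_add, mul_ite, mul_one, mul_zero]
    congr 1
    exact propext ⟨fun h => by omega, fun h => by omega⟩
  · rw [floquetFactor, Int.ediv_eq_zero_of_lt (by omega) (by omega),
      Int.emod_eq_of_lt (by omega) (by omega)]
    simp only [h, zpow_zero, one_mul, false_and, if_false, add_zero]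
    congr 1
    exact propext ⟨fun h => by omega, fun h => by omega⟩

-- Both sides are sums of indicators, so neighbours that coincide for small `q` simply add up.
open Polynomial in
theorem charmatrix_floquetHop (q : ℕ) (z : ℂ) (v : ℕ → ℂ) :
    (Matrix.of fun r s => floquetHop q z r s + if r = s then v r else 0).charmatrix =
      cyclicJacobi q (fun n => (X - C (v n) : ℂ[X])) (C z) (C z⁻¹) := by
  ext1 r s
  rw [Matrix.charmatrix_apply]
  simp only [Matrix.of_apply, floquetHop, floquetFactor_add_one, floquetFactor_sub_one,
    cyclicJacobi, Matrix.diagonal_apply, Fin.ext_iff, eq_comm (a := (s : ℕ)) (b := (r : ℕ)), C_add,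
    apply_ite C, C_0, C_1]
  split_ifs <;> ring

/-- Two antisymmetric two-site defects at distance half a period do not change the characteristic
polynomials of the one-dimensional Floquet matrices. -/
theorem charpoly_floquetHop_defect {m : ℕ} (hm : 2 ≤ m) {z : ℂ} (hz : z ≠ 0) (v : ℕ → ℂ) {a b : ℂ}
    (hab : a * b = 2) (hsq : a ^ 2 + b ^ 2 = 0) (h0 : v 0 = a) (h1 : v 1 = b) (h2 : v m = -b)
    (h3 : v (m + 1) = -a)
    (hv : ∀ n < m + m, n ≠ 0 → n ≠ 1 → n ≠ m → n ≠ m + 1 → v n = 0) :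
    (Matrix.of fun r s => floquetHop (m + m) z r s + if r = s then v r else 0).charpoly =
      (Matrix.of fun r s => floquetHop (m + m) z r s +
        if r = s then (fun _ : ℕ => (0 : ℂ)) r else 0).charpoly := by
  unfold Matrix.charpoly
  rw [charmatrix_floquetHop, charmatrix_floquetHop (v := fun _ => 0)]
  have key := trace_transferProduct_defect hm v hab hsq h0 h1 h2 h3 hv
  simp only [Polynomial.C_0, sub_zero]
  obtain ⟨p, hp⟩ : ∃ p, m + m = 2 + p := ⟨m + m - 2, by omega⟩
  rw [hp] at key ⊢
  exact det_cyclicJacobi_congr p (by rw [← Polynomial.C_mul, mul_inv_cancel₀ hz, Polynomial.C_1]) key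

/-! ### Reduction to one coordinate -/

/-- The two lattice neighbours of `n` in direction `i`. -/
def latticeNeighbour {d : ℕ} (n : Fin d → ℤ) (p : Fin d × Bool) : Fin d → ℤ :=
  n + Pi.single p.1 (if p.2 then 1 else -1)

theorem latticeNeighbour_injective {d : ℕ} (n : Fin d → ℤ) :
    Function.Injective (latticeNeighbour n) := by
  rintro ⟨i, b⟩ ⟨j, c⟩ h
  have h' := add_left_cancel h
  have hi := congrFun h' i
  simp only [Pi.single_eq_same] at hi
  by_cases hij : i = j
  · subst hij
    cases b <;> cases c <;> simp at hi ⊢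
  · rw [Pi.single_eq_of_ne hij] at hi
    cases b <;> simp at hi

theorem range_latticeNeighbour {d : ℕ} (n : Fin d → ℤ) :
    {n' : Fin d → ℤ | ∑ i, |n' i - n i| = 1} = Set.range (latticeNeighbour n) := by
  ext n'
  constructor
  · intro h
    have h : ∑ i, |n' i - n i| = 1 := h
    obtain ⟨i, -, hi⟩ : ∃ i ∈ Finset.univ, |n' i - n i| ≠ 0 :=
      Finset.exists_ne_zero_of_sum_ne_zero (by rw [h]; exact one_ne_zero)
    rw [← Finset.add_sum_erase _ _ (Finset.mem_univ i)] at h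
    have hnn : 0 ≤ ∑ j ∈ Finset.univ.erase i, |n' j - n j| :=
      Finset.sum_nonneg fun _ _ => abs_nonneg _
    have hpos : 0 < |n' i - n i| := lt_of_le_of_ne (abs_nonneg _) (Ne.symm hi)
    have hrest : ∑ j ∈ Finset.univ.erase i, |n' j - n j| = 0 := by omega
    have hone : |n' i - n i| = 1 := by omega
    rw [Finset.sum_eq_zero_iff_of_nonneg fun _ _ => abs_nonneg _] at hrest
    refine ⟨(i, decide (n' i - n i = 1)), funext fun j => ?_⟩
    simp only [latticeNeighbour, Pi.add_apply]
    by_cases hj : j = i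
    · subst hj
      rcases (abs_eq zero_le_one).1 hone with h1 | h1 <;> simp [h1] <;> omega
    · rw [Pi.single_eq_of_ne hj]
      have := abs_eq_zero.1 (hrest j (Finset.mem_erase.2 ⟨hj, Finset.mem_univ j⟩))
      omega
  · rintro ⟨⟨i, b⟩, rfl⟩
    change ∑ j, |latticeNeighbour n (i, b) j - n j| = 1
    rw [Finset.sum_eq_single i]
    · cases b <;> simp [latticeNeighbour]
    · intro j _ hj
      simp [latticeNeighbour, Pi.single_eq_of_ne hj]
    · simp

theorem discreteLaplacian_eq_sum {d : ℕ} (u : (Fin d → ℤ) → ℂ) (n : Fin d → ℤ) :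
    discreteLaplacian u n = ∑ i, (u (n + Pi.single i 1) + u (n + Pi.single i (-1))) := by
  rw [discreteLaplacian, range_latticeNeighbour, finsum_mem_range (latticeNeighbour_injective n),
    finsum_eq_sum_of_fintype, Fintype.sum_prod_type]
  simp [latticeNeighbour]

/-- The Floquet multiplier and the unit vector both factor over coordinates; this is the source of
the tensor structure. -/
theorem floquetExtension_single {d : ℕ} (q : Fin d → ℕ+) (k : Fin d → ℝ) (s : PeriodCell q)
    (n : Fin d → ℤ) :
    floquetExtension q k (Pi.single s 1) n =
      ∏ j, floquetFactor (q j) (Complex.exp (2 * Real.pi * Complex.I * (k j : ℂ))) (n j) (s j) := by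
  simp only [floquetExtension, floquetFactor, Finset.prod_mul_distrib]
  congr 1
  rw [Finset.prod_ite_zero, Finset.prod_const_one, Pi.single_apply]
  congr 1
  simp [funext_iff, cellResidue, Fin.ext_iff]

theorem floquetMatrix_apply {d : ℕ} (q : Fin d → ℕ+) (V : (Fin d → ℤ) → ℂ) (k : Fin d → ℝ)
    (r s : PeriodCell q) :
    floquetMatrix q V k r s =
      (∑ i, floquetHop (q i) (Complex.exp (2 * Real.pi * Complex.I * (k i : ℂ))) (r i) (s i) *
        if ∀ j, j ≠ i → r j = s j then 1 else 0) +
      V (cellPoint r) * if r = s then 1 else 0 := by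
  have key : ∀ (i : Fin d) (t : ℤ),
      floquetExtension q k (Pi.single s 1) (cellPoint r + Pi.single i t) =
        floquetFactor (q i) (Complex.exp (2 * Real.pi * Complex.I * (k i : ℂ)))
          (((r i : ℕ) : ℤ) + t) (s i) * if ∀ j, j ≠ i → r j = s j then 1 else 0 := by
    intro i t
    rw [floquetExtension_single, ← Finset.mul_prod_erase _ _ (Finset.mem_univ i)]
    congr 1
    · simp [cellPoint]
    · rw [Finset.prod_congr rfl (g := fun j => if r j = s j then (1 : ℂ) else 0),
        Finset.prod_ite_zero, Finset.prod_const_one]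
      · congr 1
        simp
      · intro j hj
        simp [Pi.single_eq_of_ne (Finset.ne_of_mem_erase hj), cellPoint, floquetFactor_natCast]
  have key0 : floquetExtension q k (Pi.single s 1) (cellPoint r) = if r = s then 1 else 0 := by
    simp only [floquetExtension_single, cellPoint, floquetFactor_natCast]
    rw [Finset.prod_ite_zero, Finset.prod_const_one]
    simp [funext_iff]
  rw [floquetMatrix, Matrix.of_apply, schrodinger, discreteLaplacian_eq_sum, key0]
  congr 1
  refine Finset.sum_congr rfl fun i _ => ?_
  rw [key, key, ← add_mul, floquetHop, Matrix.of_apply, sub_eq_add_neg]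

/-- For a potential that depends on a single coordinate, the Floquet matrix is a Kronecker sum
with a one-dimensional Floquet matrix. -/
theorem exists_charpoly_floquetMatrix_eq {d : ℕ} (q : Fin d → ℕ+) (k : Fin d → ℝ) (j₀ : Fin d) :
    ∃ B : Matrix ((j : {j // j ≠ j₀}) → Fin (q j)) ((j : {j // j ≠ j₀}) → Fin (q j)) ℂ,
      ∀ (V : (Fin d → ℤ) → ℂ) (v : ℕ → ℂ), (∀ r : PeriodCell q, V (cellPoint r) = v (r j₀)) →
        (floquetMatrix q V k).charpoly =
          (Polynomial.aeval B.charmatrix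
            (Matrix.of fun r s : Fin (q j₀) =>
              floquetHop (q j₀) (Complex.exp (2 * Real.pi * Complex.I * (k j₀ : ℂ))) r s +
                if r = s then v r else 0).charpoly).det := by
  -- The Floquet Laplacian in the remaining coordinates. It is fixed before `V`, so the same `B`
  -- serves `V` and `0`.
  refine ⟨Matrix.of fun r s => ∑ i : {j // j ≠ j₀}, floquetHop (q i)
    (Complex.exp (2 * Real.pi * Complex.I * (k i : ℂ))) (r i) (s i) *
        if ∀ j : {j // j ≠ j₀}, j ≠ i → r j = s j then 1 else 0, fun V v hV => ?_⟩
  rw [← charpoly_kroneckerSum, ← Matrix.charpoly_reindex (Equiv.piSplitAt j₀ fun j => Fin (q j)).symm]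
  congr 1
  ext1 r s
  rw [floquetMatrix_apply, Matrix.reindex_apply, Matrix.submatrix_apply, hV]
  simp only [Equiv.symm_symm, Equiv.piSplitAt_apply, Matrix.of_apply]
  have hrest : ((fun j : {j // j ≠ j₀} => r j) = fun j : {j // j ≠ j₀} => s j) ↔ ∀ j, j ≠ j₀ → r j = s j := by
    simp [funext_iff]
  have hall : r = s ↔ r j₀ = s j₀ ∧ ∀ j, j ≠ j₀ → r j = s j := by
    refine ⟨fun h => by simp [h], fun h => funext fun j => ?_⟩
    by_cases hj : j = j₀
    · exact hj ▸ h.1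
    · exact h.2 j hj
  rw [← Finset.add_sum_erase _ _ (Finset.mem_univ j₀)]
  have hsum : ∑ i ∈ Finset.univ.erase j₀, floquetHop (q i)
      (Complex.exp (2 * Real.pi * Complex.I * (k i : ℂ))) (r i) (s i) *
        (if ∀ j, j ≠ i → r j = s j then (1 : ℂ) else 0) =
      (if r j₀ = s j₀ then 1 else 0) * ∑ i : {j // j ≠ j₀}, floquetHop (q i)
        (Complex.exp (2 * Real.pi * Complex.I * (k i : ℂ))) (r i) (s i) *
        (if ∀ j : {j // j ≠ j₀}, j ≠ i → r j = s j then (1 : ℂ) else 0) := by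
    rw [Finset.mul_sum, Finset.sum_subtype (p := fun j => j ≠ j₀) _ (by simp)]
    refine Finset.sum_congr rfl fun i _ => ?_
    have hi : (∀ j, j ≠ (i : Fin d) → r j = s j) ↔
        r j₀ = s j₀ ∧ ∀ j : {j // j ≠ j₀}, j ≠ i → r j = s j := by
      refine ⟨fun h => ⟨h j₀ i.2.symm, fun j hj => h j fun e => hj (Subtype.ext e)⟩, fun h j hj => ?_⟩
      by_cases hj0 : j = j₀
      · exact hj0 ▸ h.1
      · exact h.2 ⟨j, hj0⟩ fun e => hj (congrArg Subtype.val e)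
    by_cases h1 : r j₀ = s j₀ <;> simp [hi, h1]
  rw [hsum]
  by_cases h1 : r j₀ = s j₀ <;> by_cases h2 : ∀ j, j ≠ j₀ → r j = s j <;>
    simp only [hrest, hall, h1, h2, and_self, true_and, and_false, false_and, if_true,
      if_false] <;> ring

/-! ### The isospectral potential -/

/-- The potential with values `1 - i, 1 + i` at `0, 1`, values `-1 - i, -1 + i` at `m, m + 1`, and
zero elsewhere. -/
noncomputable def defectPotential (m n : ℕ) : ℂ :=
  if n = 0 then 1 - Complex.I else if n = 1 then 1 + Complex.I
  else if n = m then -(1 + Complex.I) else if n = m + 1 then -(1 - Complex.I) else 0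

theorem theorem1p2 (d : ℕ) (q : Fin d → ℕ+)
    (hq : ∃ j, Even (q j : ℕ) ∧ 4 ≤ (q j : ℕ)) :
    ∃ V : (Fin d → ℤ) → ℂ,
      V ≠ 0 ∧ IsLatticePeriodic q V ∧ FloquetIsospectral q V 0 := by
  obtain ⟨j₀, ⟨m, hm⟩, h4⟩ := hq
  refine ⟨fun n => defectPotential m (n j₀ % ((q j₀ : ℕ) : ℤ)).toNat, ?_, ?_, ?_⟩
  · intro h
    have h0 := congrArg Complex.re (congrFun h 0)
    simp [defectPotential] at h0
  · intro n l hl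
    have hl0 : ((q j₀ : ℕ) : ℤ) ∣ l j₀ :=
      Int.mem_zmultiples_iff.1 ((AddSubgroup.mem_pi _).1 hl j₀ (Set.mem_univ _))
    simp only [Pi.add_apply]
    rw [Int.add_emod, Int.emod_eq_zero_of_dvd hl0, add_zero, Int.emod_emod]
  · intro k
    obtain ⟨B, hB⟩ := exists_charpoly_floquetMatrix_eq q k j₀
    rw [floquetSpectrum, floquetSpectrum, hB _ (defectPotential m), hB 0 fun _ => 0]
    · congr 3
      have hI : Complex.I ^ 2 = -1 := Complex.I_sq
      rw [hm]
      -- Non-real values are forced: no real `a, b` satisfy `ab = 2` and `a² + b² = 0`. The bound `m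
      -- ≥ 2` keeps the sites `0, 1, m, m + 1` distinct.
      exact charpoly_floquetHop_defect (by omega) (Complex.exp_ne_zero _) (defectPotential m)
        (a := 1 - Complex.I) (b := 1 + Complex.I) (by linear_combination -hI)
        (by linear_combination 2 * hI) (by simp [defectPotential]) (by simp [defectPotential])
        (by simp [defectPotential, show m ≠ 0 by omega, show m ≠ 1 by omega])
        (by simp [defectPotential, show m ≠ 0 by omega])
        fun n _ h0 h1 h2 h3 => by simp [defectPotential, h0, h1, h2, h3]
    · simp
    · intro r
      have hr := (r j₀).2
      simp only [cellPoint]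
      rw [Int.emod_eq_of_lt (by omega) (by omega), Int.toNat_natCast]
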